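/- Let $\Gamma$ be a finite connected undirected graph without loops or multiple edges, with vertex set $X$ and path-length distance $\partial$. Assume that $\Gamma$ is distance-regular with diameter $d\ge 2$: for $0\le h,i,j\le d$ and $x,y\in X$ with $\partial(x,y)=h$, the number $p^h_{i,j}=|\{z\in X:\partial(x,z)=i,\ \partial(z,y)=j\}|$ depends only on $h,i,j$. Write $c_i=p^i_{1,i-1}$ $(1\le i\le d)$, $b_i=p^i_{1,i+1}$ $(0\le i\le d-1)$, $b_d=0$. For $0\le i\le d$ let $A_i\in{\rm Mat}_X(\mathbb R)$ be the $i$th distance matrix (the $(x,y)$-entry is $1$ if $\partial(x,y)=i$ and $0$ otherwise), let $A_{-1}=A_{d+1}=0$, $A=A_1$, and let $M={\rm Span}\{A_i\}_{i=0}^d$ be the Bose–Mesner algebra. Let $\{E_i\}_{i=0}^d$ be an ordering of the primitive idempotents of $M$, that is, a basis of $M$ with $E_0=|X|^{-1}J$ ($J$ the all-ones matrix), $\sum_{i=0}^d E_i=I$ and $E_iE_j=\delta_{i,j}E_i$. Define the eigenvalues $\theta_i$ by $A=\sum_{i=0}^d\theta_iE_i$ and the Krein parameters $q^h_{i,j}$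 by $E_i\cdot E_j=|X|^{-1}\sum_{h=0}^d q^h_{i,j}E_h$, where $\cdot$ is the entry-wise product. Assume that the ordering is $Q$-polynomial: for $0\le h,i,j\le d$, $q^h_{i,j}=0$ if one of $h,i,j$ is greater than the sum of the other two, and $q^h_{i,j}\ne 0$ if one of $h,i,j$ is equal to the sum of the other two. Put $E=E_1$ and define the dual eigenvalues $\theta^*_i$ by $E=|X|^{-1}\sum_{i=0}^d\theta^*_iA_i$. Let $V=\mathbb RX$ with standard basis $\{\hat x\}_{x\in X}$, let $\circ$ be the entry-wise product on $V$, and let $u\star v=E(u\circ v)$ for $u,v\in EV$ be the Norton product on $EV$. For distinct $x,y\in X$ with $i=\partial(x,y)$ put $x^+_y=A\hat x\circ A_{i+1}\hat y$, $x^-_y=A\hat x\circ A_{i-1}\hat y$ and $$C(x,y)=Ex^-_y-c_i\frac{\theta^*_1-\theta^*_{i-1}}{\theta^*_0-\theta^*_i}E\hat x,\qquad B(x,y)=Ex^+_y-b_i\frac{\theta^*_1-\theta^*_{i+1}}{\theta^*_0-\theta^*_i}E\hat x,$$ where $\theta^*_{d+1}$ is an arbitrary number (it is multiplied by $b_d=0$).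 Then the following hold. (i) For $x,y\in X$ at distance $\partial(x,y)=1$, $$E\hat x\star E\hat y=\frac{(\theta^*_2-\theta^*_1)B(x,y)+(\theta_2-\theta_0+\theta^*_0-\theta^*_1)(E\hat x+E\hat y)}{|X|(\theta_1-\theta_2)}.$$ (ii) For $x,y\in X$ at distance $\partial(x,y)=d$, $$E\hat x\star E\hat y=\frac{(\theta^*_{d-1}-\theta^*_d)C(x,y)+(\theta_2-\theta_0)(E\hat x+E\hat y)}{|X|(\theta_1-\theta_2)}.$$ -/

import Mathlib

namespace NortonDRG

open scoped Matrix

variable {X : Type*} [Fintype X]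

/-- The set `Γ_i(x)` of vertices at distance `i` from `x`. -/
noncomputable def sphere (G : SimpleGraph X) (i : ℕ) (x : X) : Finset X :=
  Finset.univ.filter fun y => G.dist x y = i

/-- A (finite, connected) graph is distance-regular when, for all `h, i, j` between `0` and the
diameter, `|Γ_i(x) ∩ Γ_j(y)|` is the same for all pairs `x, y` at distance `h`. -/
structure DistanceRegular [DecidableEq X] (G : SimpleGraph X) : Prop where
  connected : G.Connected
  card_eq : ∀ h i j : ℕ, h ≤ G.diam → i ≤ G.diam → j ≤ G.diam →
    ∀ x y x' y' : X, G.dist x y = h → G.dist x' y' = h →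
      (sphere G i x ∩ sphere G j y).card = (sphere G i x' ∩ sphere G j y').card

/-- The intersection number `p^h_{i,j}`: the common value of `|Γ_i(x) ∩ Γ_j(y)|` over all pairs
`x, y` at distance `h`, written as the maximum over these pairs. -/
noncomputable def intersectionNumber [DecidableEq X] (G : SimpleGraph X) (h i j : ℕ) : ℕ :=
  (Finset.univ.filter fun p : X × X => G.dist p.1 p.2 = h).sup
    fun p => (sphere G i p.1 ∩ sphere G j p.2).card

/-- In a distance-regular graph, `p^h_{i,j}` is the size of `Γ_i(x) ∩ Γ_j(y)` for every pair
`x, y` at distance `h`. -/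
theorem DistanceRegular.intersectionNumber_eq [DecidableEq X] {G : SimpleGraph X}
    (hG : DistanceRegular G) {h i j : ℕ} (hh : h ≤ G.diam) (hi : i ≤ G.diam) (hj : j ≤ G.diam)
    {x y : X} (hxy : G.dist x y = h) :
    intersectionNumber G h i j = (sphere G i x ∩ sphere G j y).card := by
  apply le_antisymm
  · refine Finset.sup_le fun p hp => ?_
    exact (hG.card_eq h i j hh hi hj p.1 p.2 x y (Finset.mem_filter.mp hp).2 hxy).le
  · have hm : (x, y) ∈ Finset.univ.filter fun p : X × X => G.dist p.1 p.2 = h := by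
      simpa using hxy
    rw [intersectionNumber]
    exact Finset.le_sup_of_le hm le_rfl

/-- `c_i = p^i_{1,i-1}` for `i ≥ 1`, and `c_0 = 0`. -/
noncomputable def c [DecidableEq X] (G : SimpleGraph X) (i : ℕ) : ℕ :=
  if i = 0 then 0 else intersectionNumber G i 1 (i - 1)

/-- `b_i = p^i_{1,i+1}` (which is `0` when `i` is the diameter). -/
noncomputable def b [DecidableEq X] (G : SimpleGraph X) (i : ℕ) : ℕ :=
  intersectionNumber G i 1 (i + 1)

/-- The `i`-th distance matrix `A_i`. -/
noncomputable def distMatrix (G : SimpleGraph X) (i : ℕ) : Matrix X X ℝ :=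
  Matrix.of fun x y => if G.dist x y = i then 1 else 0

/-- The Bose-Mesner algebra `M`, as the span of `A_0, …, A_d`. -/
noncomputable def boseMesner (G : SimpleGraph X) : Submodule ℝ (Matrix X X ℝ) :=
  Submodule.span ℝ (Set.range fun i : Fin (G.diam + 1) => distMatrix G i)

theorem distMatrix_mem (G : SimpleGraph X) (i : Fin (G.diam + 1)) :
    distMatrix G i ∈ boseMesner G :=
  Submodule.subset_span ⟨i, rfl⟩

/-- The adjacency matrix `A = A_1` lies in `M`. -/
theorem distMatrix_one_mem (G : SimpleGraph X) (hd : 1 ≤ G.diam) :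
    distMatrix G 1 ∈ boseMesner G :=
  distMatrix_mem G ⟨1, by omega⟩

theorem exists_dist_eq {G : SimpleGraph X} (hG : G.Connected) (i : ℕ) (hi : i ≤ G.diam) :
    ∃ x y : X, G.dist x y = i := by
  have := hG.nonempty
  obtain ⟨u, v, huv⟩ := G.exists_dist_eq_diam
  obtain ⟨p, hp⟩ := hG.exists_walk_length_eq_dist u v
  refine ⟨u, p.getVert i, ?_⟩
  have h1 := G.dist_le (p.take i)
  have h2 := G.dist_le (p.drop i)
  have h3 := hG.dist_triangle (u := u) (v := p.getVert i) (w := v)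
  rw [SimpleGraph.Walk.take_length] at h1
  rw [SimpleGraph.Walk.drop_length] at h2
  omega

theorem linearIndependent_distMatrix {G : SimpleGraph X} (hG : G.Connected) :
    LinearIndependent ℝ fun i : Fin (G.diam + 1) => distMatrix G i := by
  rw [Fintype.linearIndependent_iff]
  intro g hg i
  obtain ⟨x, y, hxy⟩ := exists_dist_eq hG i (by omega)
  have h := congrFun (congrFun hg x) y
  simpa [Matrix.sum_apply, distMatrix, hxy, ← Fin.ext_iff] using h

/-- The basis `A_0, …, A_d` of `M`. -/
noncomputable def distBasis {G : SimpleGraph X} (hG : G.Connected) :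
    Module.Basis (Fin (G.diam + 1)) ℝ (boseMesner G) :=
  Module.Basis.span (linearIndependent_distMatrix hG)

/-- `M` is closed under the entry-wise product of matrices. -/
theorem hadamard_mem {G : SimpleGraph X} {S T : Matrix X X ℝ} (hS : S ∈ boseMesner G)
    (hT : T ∈ boseMesner G) : S ⊙ T ∈ boseMesner G := by
  induction hS using Submodule.span_induction with
  | mem S hS =>
    obtain ⟨i, rfl⟩ := hS
    induction hT using Submodule.span_induction with
    | mem T hT =>
      obtain ⟨j, rfl⟩ := hT
      by_cases hij : i = j
      · subst hij
        convert distMatrix_mem G i using 1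
        ext x y
        simp [distMatrix, Matrix.hadamard_apply]
      · convert (boseMesner G).zero_mem using 1
        ext x y
        have : (i : ℕ) ≠ j := fun h => hij (Fin.ext h)
        simp only [distMatrix, Matrix.hadamard_apply, Matrix.of_apply, Matrix.zero_apply]
        split_ifs <;> simp_all
    | zero => simp
    | add T T' _ _ h h' => rw [Matrix.hadamard_add]; exact add_mem h h'
    | smul r T _ h => rw [Matrix.hadamard_smul]; exact Submodule.smul_mem _ _ h
  | zero => simp
  | add S S' _ _ h h' => rw [Matrix.add_hadamard]; exact add_mem h h'
  | smul r S _ h => rw [Matrix.smul_hadamard]; exact Submodule.smul_mem _ _ h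

/-- `E_0, …, E_d` is a basis of `M` consisting of the primitive idempotents:
`E_0 = |X|⁻¹ J`, `I = ∑ E_i` and `E_i E_j = δ_{ij} E_i`. -/
structure IsPrimitiveIdempotents [DecidableEq X] {G : SimpleGraph X}
    (E : Module.Basis (Fin (G.diam + 1)) ℝ (boseMesner G)) : Prop where
  trivial_eq : (E 0 : Matrix X X ℝ) = (Fintype.card X : ℝ)⁻¹ • Matrix.of fun _ _ => 1
  sum_eq : ∑ i, (E i : Matrix X X ℝ) = 1
  mul_eq : ∀ i j, (E i : Matrix X X ℝ) * (E j : Matrix X X ℝ) =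
    if i = j then (E i : Matrix X X ℝ) else 0

/-- The eigenvalues `θ_i`, where `A = ∑ θ_i E_i`. They are indexed by natural numbers,
with value `0` for `i > d`. -/
noncomputable def eigenvalue {G : SimpleGraph X} (hd : 1 ≤ G.diam)
    (E : Module.Basis (Fin (G.diam + 1)) ℝ (boseMesner G)) (i : ℕ) : ℝ :=
  if hi : i < G.diam + 1 then E.repr ⟨distMatrix G 1, distMatrix_one_mem G hd⟩ ⟨i, hi⟩ else 0

/-- The Krein parameters `q^h_{i,j}`, where `E_i ⊙ E_j = |X|⁻¹ ∑_h q^h_{i,j} E_h`. -/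
noncomputable def kreinParameter {G : SimpleGraph X}
    (E : Module.Basis (Fin (G.diam + 1)) ℝ (boseMesner G)) (h i j : Fin (G.diam + 1)) : ℝ :=
  E.repr ((Fintype.card X : ℝ) •
    (⟨(E i : Matrix X X ℝ) ⊙ (E j : Matrix X X ℝ), hadamard_mem (E i).2 (E j).2⟩ :
      boseMesner G)) h

/-- The ordering `E_1, …, E_d` of the nontrivial primitive idempotents is `Q`-polynomial. -/
structure IsQPolynomial [DecidableEq X] {G : SimpleGraph X}
    (E : Module.Basis (Fin (G.diam + 1)) ℝ (boseMesner G)) : Prop where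
  primitive : IsPrimitiveIdempotents E
  krein_eq_zero : ∀ h i j : Fin (G.diam + 1),
    (i : ℕ) + j < h ∨ (h : ℕ) + j < i ∨ (h : ℕ) + i < j → kreinParameter E h i j = 0
  krein_ne_zero : ∀ h i j : Fin (G.diam + 1),
    (h : ℕ) = i + j ∨ (i : ℕ) = h + j ∨ (j : ℕ) = h + i → kreinParameter E h i j ≠ 0

/-- The dual eigenvalues `θ*_i` associated with `F ∈ M`, where `F = |X|⁻¹ ∑ θ*_i A_i`.
They are indexed by natural numbers, with value `0` for `i > d`. -/
noncomputable def dualEigenvalue {G : SimpleGraph X} (hG : G.Connected) (F : boseMesner G)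
    (i : ℕ) : ℝ :=
  if hi : i < G.diam + 1 then (distBasis hG).repr ((Fintype.card X : ℝ) • F) ⟨i, hi⟩ else 0

/-- The vector space `FV`, where `V = ℝX`. -/
noncomputable def imageSpace (F : Matrix X X ℝ) : Submodule ℝ (X → ℝ) :=
  LinearMap.range F.mulVecLin

/-- The map `v ↦ Fv` from `V` to `FV`. -/
noncomputable def toImage (F : Matrix X X ℝ) : (X → ℝ) →ₗ[ℝ] imageSpace F :=
  F.mulVecLin.rangeRestrict

/-- The Norton product `u ⋆ v = F (u ∘ v)` on `FV`, where `∘` is the entry-wise product. -/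
noncomputable def nortonMul (F : Matrix X X ℝ) (u v : imageSpace F) : imageSpace F :=
  toImage F ((u : X → ℝ) * (v : X → ℝ))

/-- The vector `x̂`. -/
noncomputable def hat [DecidableEq X] (x : X) : X → ℝ := Pi.single x 1

/-- `x⁺_y = A x̂ ∘ A_{i+1} ŷ`, where `i = ∂(x,y)`. -/
noncomputable def xPlus [DecidableEq X] (G : SimpleGraph X) (x y : X) : X → ℝ :=
  (distMatrix G 1 *ᵥ hat x) * (distMatrix G (G.dist x y + 1) *ᵥ hat y)

/-- `x⁻_y = A x̂ ∘ A_{i-1} ŷ`, where `i = ∂(x,y)` and `A_{-1} = 0`. -/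
noncomputable def xMinus [DecidableEq X] (G : SimpleGraph X) (x y : X) : X → ℝ :=
  if G.dist x y = 0 then 0
  else (distMatrix G 1 *ᵥ hat x) * (distMatrix G (G.dist x y - 1) *ᵥ hat y)

/-- `C(x,y) = F x⁻_y - c_i (θ*_1 - θ*_{i-1}) / (θ*_0 - θ*_i) F x̂`, for distinct `x, y`
at distance `i`. -/
noncomputable def vecC [DecidableEq X] {G : SimpleGraph X} (hG : G.Connected)
    (F : boseMesner G) (x y : X) : imageSpace (F : Matrix X X ℝ) :=
  toImage (F : Matrix X X ℝ) (xMinus G x y) -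
    ((c G (G.dist x y) : ℝ) *
      ((dualEigenvalue hG F 1 - dualEigenvalue hG F (G.dist x y - 1)) /
        (dualEigenvalue hG F 0 - dualEigenvalue hG F (G.dist x y)))) •
      toImage (F : Matrix X X ℝ) (hat x)

/-- `B(x,y) = F x⁺_y - b_i (θ*_1 - θ*_{i+1}) / (θ*_0 - θ*_i) F x̂`, for distinct `x, y`
at distance `i`. (For `i = d` the coefficient is `0`, since `b_d = 0`.) -/
noncomputable def vecB [DecidableEq X] {G : SimpleGraph X} (hG : G.Connected)
    (F : boseMesner G) (x y : X) : imageSpace (F : Matrix X X ℝ) :=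
  toImage (F : Matrix X X ℝ) (xPlus G x y) -
    ((b G (G.dist x y) : ℝ) *
      ((dualEigenvalue hG F 1 - dualEigenvalue hG F (G.dist x y + 1)) /
        (dualEigenvalue hG F 0 - dualEigenvalue hG F (G.dist x y)))) •
      toImage (F : Matrix X X ℝ) (hat x)

end NortonDRG

open NortonDRG

namespace NortonDRG

open scoped Matrix

/-! ### Entries of matrices in the Bose-Mesner algebra and expansions in its two bases -/

section General

variable {X : Type*} [Fintype X] {G : SimpleGraph X}

/-! Let `K = E A*`, where `A*` is the diagonal matrix with diagonal `E ŷ`, so that `E x̂ ⋆ E ŷ` is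
`K E x̂`. The triple product relations turn vanishing Krein parameters into `K E_l = 0` for `l ≥ 3`.
Hence `K` and `K A` are combinations of `K E_0`, `K E_1`, `K E_2`, and eliminating `K E_2` expresses
`(θ_1 - θ_2) K E_1` through `K A`, `K` and `K E_0`. Applied to `x̂`, this is
`card_mul_nortonMul_apply`, whose only nontrivial term is `E (A x̂ ∘ θ*(y))`.

At distance `1` the neighbours of `x` are `y` itself or lie at distance `1` or `2` from `y`; at
distance `d` they lie at distance `d-1` or `d`. In each case `A x̂ ∘ θ*(y) = θ*_i A x̂ + r` with `r`
a combination of `ŷ` and `x⁺_y`, or a multiple of `x⁻_y`, and `E A = θ_1 E` handles the rest.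

The coefficient of `E x̂` is now `(θ_1 - θ_2) θ*_i`, and a scalar identity must convert it to the
stated form. That identity comes from the equality of the `x`- and `y`-entries of `E x̂ ⋆ E ŷ`,
which holds because `(E ∘ E) E` is a multiple of `E` and so is symmetric
(`card_mul_mulVec_sub_mulVec`). The divisions are legitimate by `eigenvalue_ne` and
`dualEigenvalue_zero_ne`. -/

theorem boseMesner_apply_eq_of_dist_eq {S : Matrix X X ℝ} (hS : S ∈ boseMesner G) {x y x' y' : X}
    (h : G.dist x y = G.dist x' y') : S x y = S x' y' := by
  induction hS using Submodule.span_induction with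
  | mem S hS => obtain ⟨i, rfl⟩ := hS; simp [distMatrix, h]
  | zero => rfl
  | add S T _ _ hS hT => simp [hS, hT]
  | smul r S _ hS => simp [hS]

theorem boseMesner_apply_comm {S : Matrix X X ℝ} (hS : S ∈ boseMesner G) (x y : X) :
    S x y = S y x :=
  boseMesner_apply_eq_of_dist_eq hS G.dist_comm

/-- A finite connected graph has finite extended diameter, so `diam` is not the default value `0` of
the infinite case and bounds all distances. -/
theorem dist_lt_diam_add_one (hG : G.Connected) (x y : X) : G.dist x y < G.diam + 1 := by
  have := hG.nonempty
  have h : G.ediam ≠ ⊤ := SimpleGraph.connected_iff_ediam_ne_top.mp hG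
  exact Nat.lt_succ_of_le (SimpleGraph.dist_le_diam h)

theorem card_ne_zero_of_connected (hG : G.Connected) : (Fintype.card X : ℝ) ≠ 0 := by
  have := hG.nonempty
  exact_mod_cast Fintype.card_ne_zero

@[simp]
theorem coe_distBasis (hG : G.Connected) (i : Fin (G.diam + 1)) :
    (distBasis hG i : Matrix X X ℝ) = distMatrix G i :=
  congrArg Subtype.val (Module.Basis.span_apply (linearIndependent_distMatrix hG) i)

/-- The entries of `F = |X|⁻¹ ∑ θ*_i A_i`. -/
theorem card_mul_apply_eq_dualEigenvalue (hG : G.Connected) (F : boseMesner G) (x y : X) :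
    (Fintype.card X : ℝ) * (F : Matrix X X ℝ) x y = dualEigenvalue hG F (G.dist x y) := by
  have hlt := dist_lt_diam_add_one hG x y
  have h := (distBasis hG).sum_repr ((Fintype.card X : ℝ) • F)
  have h2 := congrFun (congrFun (congrArg (fun S : boseMesner G => (S : Matrix X X ℝ)) h) x) y
  simp only [Submodule.coe_sum, Submodule.coe_smul, Matrix.sum_apply, Matrix.smul_apply,
    smul_eq_mul] at h2
  rw [← h2, dualEigenvalue, dif_pos hlt, Finset.sum_eq_single ⟨G.dist x y, hlt⟩]
  · simp [distMatrix]
  · intro j _ hj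
    have : G.dist x y ≠ j := fun h => hj (Fin.ext h.symm)
    simp [distMatrix, this]
  · simp

theorem apply_eq_dualEigenvalue (hG : G.Connected) (F : boseMesner G) (x y : X) :
    (F : Matrix X X ℝ) x y = (Fintype.card X : ℝ)⁻¹ * dualEigenvalue hG F (G.dist x y) := by
  rw [← card_mul_apply_eq_dualEigenvalue hG, inv_mul_cancel_left₀ (card_ne_zero_of_connected hG)]

/-- `A = ∑ θ_i E_i`. -/
theorem distMatrix_one_eq_sum (hd : 1 ≤ G.diam)
    (E : Module.Basis (Fin (G.diam + 1)) ℝ (boseMesner G)) :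
    distMatrix G 1 = ∑ i : Fin (G.diam + 1), eigenvalue hd E i • (E i : Matrix X X ℝ) := by
  have h := congrArg (fun S : boseMesner G => (S : Matrix X X ℝ))
    (E.sum_repr ⟨distMatrix G 1, distMatrix_one_mem G hd⟩)
  simp only [Submodule.coe_sum, Submodule.coe_smul] at h
  rw [← h]
  exact Finset.sum_congr rfl fun i _ => by rw [eigenvalue, dif_pos i.2]

/-- `E_i ∘ E_j = |X|⁻¹ ∑ q^h_{i,j} E_h`. -/
theorem card_smul_hadamard_eq_sum (E : Module.Basis (Fin (G.diam + 1)) ℝ (boseMesner G))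
    (i j : Fin (G.diam + 1)) :
    (Fintype.card X : ℝ) • ((E i : Matrix X X ℝ) ⊙ (E j : Matrix X X ℝ)) =
      ∑ h, kreinParameter E h i j • (E h : Matrix X X ℝ) := by
  have h := congrArg (fun S : boseMesner G => (S : Matrix X X ℝ))
    (E.sum_repr ((Fintype.card X : ℝ) •
      (⟨(E i : Matrix X X ℝ) ⊙ (E j : Matrix X X ℝ), hadamard_mem (E i).2 (E j).2⟩ :
      boseMesner G)))
  simp only [Submodule.coe_sum, Submodule.coe_smul] at h
  exact h.symm

end General

/-! ### Distinctness of the eigenvalues, and of `θ*_0` from the other dual eigenvalues -/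

section Distinctness

variable {X : Type*} [Fintype X] [DecidableEq X] {G : SimpleGraph X}

/-- The dual eigenvalues of the first idempotent satisfy `θ*_0 ≠ θ*_i` for `1 ≤ i ≤ d`, because
`E_1` generates the Bose-Mesner algebra under the entry-wise product. -/
theorem dualEigenvalue_zero_ne (hG : G.Connected)
    {E : Module.Basis (Fin (G.diam + 1)) ℝ (boseMesner G)} (hE : IsQPolynomial E)
    (hd : 1 ≤ G.diam) {x y : X} (hxy : x ≠ y) :
    dualEigenvalue hG (E 1) 0 ≠ dualEigenvalue hG (E 1) (G.dist x y) := by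
  intro heq
  -- The numeral `1` in `Fin (d + 1)` means `1` modulo `d + 1`, so `d ≥ 1` is needed here.
  have h1 : ((1 : Fin (G.diam + 1)) : ℕ) = 1 := by
    rw [Fin.val_one', Nat.mod_eq_of_lt (by omega)]
  have hE1 : (E 1 : Matrix X X ℝ) x x = (E 1 : Matrix X X ℝ) x y := by
    rw [apply_eq_dualEigenvalue hG, apply_eq_dualEigenvalue hG, SimpleGraph.dist_self, heq]
  -- Since `q^{j+1}_{1,j} ≠ 0` and `q^h_{1,j} = 0` for `h > j + 1`, the idempotent `E_{j+1}` is a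
  -- combination of `E_1 ∘ E_j` and `E_0, …, E_j`. Equality of the `(x,x)`- and `(x,y)`-entries
  -- therefore propagates from `E_0` and `E_1` to every `E_k`.
  have key : ∀ k (hk : k < G.diam + 1),
      (E ⟨k, hk⟩ : Matrix X X ℝ) x x = (E ⟨k, hk⟩ : Matrix X X ℝ) x y := by
    intro k
    induction k using Nat.strong_induction_on with
    | _ k ih =>
      intro hk
      rcases Nat.eq_zero_or_pos k with rfl | hpos
      · have : (⟨0, hk⟩ : Fin (G.diam + 1)) = 0 := rfl
        rw [this, hE.primitive.trivial_eq]; simp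
      obtain ⟨j, rfl⟩ : ∃ j, k = j + 1 := ⟨k - 1, by omega⟩
      have hj : j < G.diam + 1 := by omega
      have hsum := card_smul_hadamard_eq_sum E 1 ⟨j, hj⟩
      have hq : kreinParameter E ⟨j + 1, hk⟩ 1 ⟨j, hj⟩ ≠ 0 :=
        hE.krein_ne_zero _ _ _ (Or.inl (by simp only [h1]; omega))
      have hterm : ∀ z, ((Fintype.card X : ℝ) •
            ((E 1 : Matrix X X ℝ) ⊙ (E ⟨j, hj⟩ : Matrix X X ℝ))) x z =
          kreinParameter E ⟨j + 1, hk⟩ 1 ⟨j, hj⟩ * (E ⟨j + 1, hk⟩ : Matrix X X ℝ) x z +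
            ∑ h ∈ Finset.univ.erase ⟨j + 1, hk⟩,
              kreinParameter E h 1 ⟨j, hj⟩ * (E h : Matrix X X ℝ) x z := by
        intro z
        rw [hsum, Finset.add_sum_erase _
          (fun h => kreinParameter E h 1 ⟨j, hj⟩ * (E h : Matrix X X ℝ) x z) (Finset.mem_univ _)]
        simp [Matrix.sum_apply]
      have hrest : ∑ h ∈ Finset.univ.erase ⟨j + 1, hk⟩,
            kreinParameter E h 1 ⟨j, hj⟩ * (E h : Matrix X X ℝ) x x =
          ∑ h ∈ Finset.univ.erase ⟨j + 1, hk⟩,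
            kreinParameter E h 1 ⟨j, hj⟩ * (E h : Matrix X X ℝ) x y := by
        refine Finset.sum_congr rfl fun h hh => ?_
        have hne : (h : ℕ) ≠ j + 1 := fun e => (Finset.mem_erase.mp hh).1 (Fin.ext e)
        rcases lt_or_gt_of_ne hne with hlt | hgt
        · rw [ih h hlt h.2]
        · rw [hE.krein_eq_zero h 1 ⟨j, hj⟩ (Or.inl (by simp only [h1]; omega)), zero_mul, zero_mul]
      have hx := hterm x
      have hy := hterm y
      rw [← hrest] at hy
      simp only [Matrix.smul_apply, Matrix.hadamard_apply] at hx hy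
      rw [← ih j (by omega) hj, ← hE1] at hy
      exact mul_left_cancel₀ hq (by linarith)
  -- Summing over `k` gives the identity matrix equal entries at `(x,x)` and `(x,y)`, which is
  -- absurd.
  have hI := hE.primitive.sum_eq
  have hxx := congrFun (congrFun hI x) x
  have hxy' := congrFun (congrFun hI x) y
  rw [Matrix.sum_apply] at hxx hxy'
  rw [Matrix.one_apply_eq] at hxx
  rw [Matrix.one_apply_ne hxy, ← Finset.sum_congr rfl fun (i : Fin (G.diam + 1)) _ => key i i.2]
    at hxy'
  exact one_ne_zero (hxx.symm.trans hxy')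

theorem distMatrix_mul_idempotent (hd : 1 ≤ G.diam)
    {E : Module.Basis (Fin (G.diam + 1)) ℝ (boseMesner G)} (hE : IsPrimitiveIdempotents E)
    (i : Fin (G.diam + 1)) :
    distMatrix G 1 * (E i : Matrix X X ℝ) = eigenvalue hd E i • (E i : Matrix X X ℝ) := by
  simp [distMatrix_one_eq_sum hd E, Finset.sum_mul, hE.mul_eq]

theorem idempotent_mul_distMatrix (hd : 1 ≤ G.diam)
    {E : Module.Basis (Fin (G.diam + 1)) ℝ (boseMesner G)} (hE : IsPrimitiveIdempotents E)
    (i : Fin (G.diam + 1)) :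
    (E i : Matrix X X ℝ) * distMatrix G 1 = eigenvalue hd E i • (E i : Matrix X X ℝ) := by
  simp [distMatrix_one_eq_sum hd E, Finset.mul_sum, hE.mul_eq]

theorem distMatrix_one_mul_apply (i : ℕ) (x y : X) :
    (distMatrix G 1 * distMatrix G i) x y = ((sphere G 1 x ∩ sphere G i y).card : ℝ) := by
  rw [Matrix.mul_apply, Finset.card_eq_sum_ones, Nat.cast_sum, sphere, sphere,
    ← Finset.filter_and, Finset.sum_filter]
  refine Finset.sum_congr rfl fun z _ => ?_
  rw [G.dist_comm (u := y)]
  by_cases h1 : G.dist x z = 1 <;> by_cases h2 : G.dist z y = i <;> simp [distMatrix, h1, h2]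

/-- `A A_i = ∑_j p^j_{1,i} A_j`. -/
theorem distMatrix_one_mul (hG : DistanceRegular G) (hd : 1 ≤ G.diam) {i : ℕ} (hi : i ≤ G.diam) :
    distMatrix G 1 * distMatrix G i =
      ∑ j : Fin (G.diam + 1), (intersectionNumber G j 1 i : ℝ) • distMatrix G j := by
  ext x y
  have hlt := dist_lt_diam_add_one hG.connected x y
  rw [distMatrix_one_mul_apply, Matrix.sum_apply, Finset.sum_eq_single ⟨G.dist x y, hlt⟩,
    ← hG.intersectionNumber_eq (Nat.lt_succ_iff.mp hlt) hd hi rfl]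
  · simp [distMatrix]
  · intro j _ hj
    have : G.dist x y ≠ j := fun h => hj (Fin.ext h.symm)
    simp [distMatrix, this]
  · simp

/-- The triangle inequality. With the next lemma it shows that `A A_i` has leading term a nonzero
multiple of `A_{i+1}`. -/
theorem intersectionNumber_eq_zero (hG : DistanceRegular G) (hd : 1 ≤ G.diam) {i j : ℕ}
    (hj : j ≤ G.diam) (hij : i + 1 < j) : intersectionNumber G j 1 i = 0 := by
  obtain ⟨x, y, hxy⟩ := exists_dist_eq hG.connected j hj
  rw [hG.intersectionNumber_eq hj hd (by omega) hxy, Finset.card_eq_zero,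
    Finset.eq_empty_iff_forall_notMem]
  intro z hz
  simp only [sphere, Finset.mem_inter, Finset.mem_filter, Finset.mem_univ, true_and] at hz
  have := hG.connected.dist_triangle (u := x) (v := z) (w := y)
  rw [G.dist_comm (u := z)] at this
  omega

/-- The first step along a geodesic from `x` to `y` is a vertex of the set being counted. -/
theorem intersectionNumber_ne_zero (hG : DistanceRegular G) {i : ℕ} (hi : i + 1 ≤ G.diam) :
    intersectionNumber G (i + 1) 1 i ≠ 0 := by
  obtain ⟨x, y, hxy⟩ := exists_dist_eq hG.connected (i + 1) hi
  rw [hG.intersectionNumber_eq hi (by omega) (by omega) hxy]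
  obtain ⟨p, hp⟩ := hG.connected.exists_walk_length_eq_dist x y
  have h1 := G.dist_le (p.take 1)
  have h2 := G.dist_le (p.drop 1)
  have h3 := hG.connected.dist_triangle (u := x) (v := p.getVert 1) (w := y)
  rw [SimpleGraph.Walk.take_length] at h1
  rw [SimpleGraph.Walk.drop_length] at h2
  refine Finset.card_ne_zero_of_mem (a := p.getVert 1) ?_
  simp only [sphere, Finset.mem_inter, Finset.mem_filter, Finset.mem_univ, true_and]
  rw [G.dist_comm (u := y)]
  omega

/-- The eigenvalues are mutually distinct, because `A` generates the Bose-Mesner algebra. -/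
theorem eigenvalue_ne (hG : DistanceRegular G) (hd : 1 ≤ G.diam)
    {E : Module.Basis (Fin (G.diam + 1)) ℝ (boseMesner G)} (hE : IsPrimitiveIdempotents E)
    {r s : Fin (G.diam + 1)} (hrs : r ≠ s) : eigenvalue hd E r ≠ eigenvalue hd E s := by
  intro heq
  -- The matrices acting on `E_r` and `E_s` by the same scalar. If `θ_r = θ_s`, this space is stable
  -- under left multiplication by `A`.
  let N : Submodule ℝ (Matrix X X ℝ) :=
    { carrier := {S | ∃ c : ℝ, S * (E r : Matrix X X ℝ) = c • (E r : Matrix X X ℝ) ∧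
        S * (E s : Matrix X X ℝ) = c • (E s : Matrix X X ℝ)}
      zero_mem' := ⟨0, by simp, by simp⟩
      add_mem' := by
        rintro S T ⟨a, h1, h2⟩ ⟨b, h3, h4⟩
        exact ⟨a + b, by rw [add_mul, h1, h3, add_smul], by rw [add_mul, h2, h4, add_smul]⟩
      smul_mem' := by
        rintro t S ⟨a, h1, h2⟩
        exact ⟨t * a, by rw [Matrix.smul_mul, h1, smul_smul],
          by rw [Matrix.smul_mul, h2, smul_smul]⟩ }
  have hmul : ∀ S ∈ N, distMatrix G 1 * S ∈ N := by
    rintro S ⟨a, h1, h2⟩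
    refine ⟨a * eigenvalue hd E r, ?_, ?_⟩
    · rw [mul_assoc, h1, Matrix.mul_smul, distMatrix_mul_idempotent hd hE, smul_smul]
    · rw [mul_assoc, h2, Matrix.mul_smul, distMatrix_mul_idempotent hd hE, smul_smul, heq]
  have key : ∀ k ≤ G.diam, distMatrix G k ∈ N := by
    intro k
    induction k using Nat.strong_induction_on with
    | _ k ih =>
      intro hk
      rcases Nat.eq_zero_or_pos k with rfl | hpos
      · have : distMatrix G 0 = 1 := by
          ext x y
          simp [distMatrix, Matrix.one_apply, hG.connected.dist_eq_zero_iff]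
        rw [this]
        exact ⟨1, by simp, by simp⟩
      obtain ⟨j, rfl⟩ : ∃ j, k = j + 1 := ⟨k - 1, by omega⟩
      have hsum := distMatrix_one_mul hG hd (i := j) (by omega)
      have hmem := hmul _ (ih j (by omega) (by omega))
      rw [hsum, ← Finset.add_sum_erase _ _
        (Finset.mem_univ (⟨j + 1, by omega⟩ : Fin (G.diam + 1)))] at hmem
      have hrest : ∑ i ∈ Finset.univ.erase (⟨j + 1, by omega⟩ : Fin (G.diam + 1)),
          (intersectionNumber G i 1 j : ℝ) • distMatrix G i ∈ N := by
        refine N.sum_mem fun i hi => ?_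
        have hne : (i : ℕ) ≠ j + 1 := fun e => (Finset.mem_erase.mp hi).1 (Fin.ext e)
        rcases lt_or_gt_of_ne hne with hlt | hgt
        · exact N.smul_mem _ (ih i hlt (by omega))
        · rw [intersectionNumber_eq_zero hG hd (by omega) hgt]
          simp
      have := (N.add_mem_iff_left hrest).mp hmem
      exact (N.smul_mem_iff (by exact_mod_cast intersectionNumber_ne_zero hG hk)).mp this
  -- Thus `E_r` itself acts on `E_r` and `E_s` by one scalar `a`: `E_r E_s = 0` forces `a = 0`,
  -- contradicting `E_r E_r = E_r ≠ 0`.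
  have hle : boseMesner G ≤ N := by
    refine Submodule.span_le.mpr ?_
    rintro _ ⟨i, rfl⟩
    exact key i (by omega)
  obtain ⟨a, h1, h2⟩ := hle (E r).2
  rw [hE.mul_eq, if_pos rfl] at h1
  rw [hE.mul_eq, if_neg hrs] at h2
  have hne : ∀ i, (E i : Matrix X X ℝ) ≠ 0 := fun i h => E.ne_zero i (Subtype.ext h)
  have ha : a = 0 := (smul_eq_zero.mp h2.symm).resolve_right (hne s)
  rw [ha, zero_smul] at h1
  exact hne r h1

end Distinctness

/-! ### Triple product relations and the Norton product of two vertices -/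

section TripleProduct

variable {X : Type*} [Fintype X] [DecidableEq X] {G : SimpleGraph X}

/-- `E_i A*_j(x) E_k = 0` whenever `q^j_{i,k} = 0`, where `A*_j(x)` is the diagonal matrix with
diagonal `E_j x̂`. -/
theorem idempotent_mul_diagonal_mul_eq_zero (hG : G.Connected)
    {E : Module.Basis (Fin (G.diam + 1)) ℝ (boseMesner G)} (hE : IsPrimitiveIdempotents E)
    {i j k : Fin (G.diam + 1)} (hq : kreinParameter E j i k = 0) (x : X) :
    (E i : Matrix X X ℝ) * Matrix.diagonal ((E j : Matrix X X ℝ) x) * (E k : Matrix X X ℝ) = 0 := by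
  have hsymm : ∀ l, (E l : Matrix X X ℝ)ᵀ = E l := fun l =>
    Matrix.ext fun y z => boseMesner_apply_comm (E l).2 z y
  have hidem : ∀ l, (E l : Matrix X X ℝ) * (E l : Matrix X X ℝ) = E l := fun l => by
    rw [hE.mul_eq, if_pos rfl]
  set D := Matrix.diagonal ((E j : Matrix X X ℝ) x) with hD
  -- A real matrix `S` vanishes once the trace of `S Sᵀ` does. Here that trace is the quadratic form
  -- of `E_i ∘ E_k` at the vector `E_j x̂`, an eigenvector with eigenvalue `|X|⁻¹ q^j_{i,k} = 0`.
  rw [← Matrix.trace_mul_conjTranspose_self_eq_zero_iff]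
  have hconj : ((E i : Matrix X X ℝ) * D * (E k : Matrix X X ℝ))ᴴ =
      (E k : Matrix X X ℝ) * D * (E i : Matrix X X ℝ) := by
    rw [Matrix.conjTranspose_eq_transpose_of_trivial, Matrix.transpose_mul, Matrix.transpose_mul,
      hsymm, hsymm, hD, Matrix.diagonal_transpose, mul_assoc]
  rw [hconj]
  have h1 : (E i : Matrix X X ℝ) * D * (E k : Matrix X X ℝ) *
      ((E k : Matrix X X ℝ) * D * (E i : Matrix X X ℝ)) =
      (E i : Matrix X X ℝ) * (D * (E k : Matrix X X ℝ) * D * (E i : Matrix X X ℝ)) := by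
    conv_rhs => rw [← hidem k]
    simp only [mul_assoc]
  rw [h1, Matrix.trace_mul_comm, mul_assoc, hidem]
  have h2 : (D * (E k : Matrix X X ℝ) * D * (E i : Matrix X X ℝ)).trace =
      ((E j : Matrix X X ℝ) x) ⬝ᵥ
        (((E i : Matrix X X ℝ) ⊙ (E k : Matrix X X ℝ)) *ᵥ ((E j : Matrix X X ℝ) x)) := by
    rw [Matrix.trace, dotProduct]
    refine Finset.sum_congr rfl fun s _ => ?_
    rw [Matrix.diag_apply, Matrix.mul_apply, Matrix.mulVec, dotProduct, Finset.mul_sum]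
    refine Finset.sum_congr rfl fun t _ => ?_
    rw [hD, Matrix.mul_diagonal, Matrix.diagonal_mul, Matrix.hadamard_apply,
      boseMesner_apply_comm (E i).2 t s]
    ring
  rw [h2]
  have h3 : ∀ l, (E l : Matrix X X ℝ) *ᵥ ((E j : Matrix X X ℝ) x) =
      if l = j then (E j : Matrix X X ℝ) x else 0 := by
    intro l
    have hrow : (E j : Matrix X X ℝ) x = (E j : Matrix X X ℝ) *ᵥ Pi.single x 1 := by
      ext z
      simp [boseMesner_apply_comm (E j).2 x z]
    rw [hrow, Matrix.mulVec_mulVec, hE.mul_eq]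
    split_ifs with h
    · rw [h]
    · rw [Matrix.zero_mulVec]
  have h4 : (Fintype.card X : ℝ) •
      (((E i : Matrix X X ℝ) ⊙ (E k : Matrix X X ℝ)) *ᵥ ((E j : Matrix X X ℝ) x)) = 0 := by
    rw [← Matrix.smul_mulVec, card_smul_hadamard_eq_sum, Matrix.sum_mulVec]
    refine Finset.sum_eq_zero fun l _ => ?_
    rw [Matrix.smul_mulVec, h3]
    split_ifs with h
    · rw [h, hq, zero_smul]
    · simp
  rw [(smul_eq_zero.mp h4).resolve_left (card_ne_zero_of_connected hG), dotProduct_zero]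

/-- `(θ_1 - θ_2) E A* E = E A* A - θ_2 E A* - (θ_0 - θ_2) E A* E_0`. -/
theorem smul_idempotent_mul_diagonal_mul (hG : G.Connected) (hd : 2 ≤ G.diam)
    {E : Module.Basis (Fin (G.diam + 1)) ℝ (boseMesner G)} (hE : IsQPolynomial E) (x : X)
    {K : Matrix X X ℝ}
    (hK : K = (E 1 : Matrix X X ℝ) * Matrix.diagonal ((E 1 : Matrix X X ℝ) x)) :
    (eigenvalue (one_le_two.trans hd) E 1 - eigenvalue (one_le_two.trans hd) E 2) •
        (K * (E 1 : Matrix X X ℝ)) =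
      K * distMatrix G 1 - eigenvalue (one_le_two.trans hd) E 2 • K -
        (eigenvalue (one_le_two.trans hd) E 0 - eigenvalue (one_le_two.trans hd) E 2) •
          (K * (E 0 : Matrix X X ℝ)) := by
  have hd1 := one_le_two.trans hd
  have v1 : ((1 : Fin (G.diam + 1)) : ℕ) = 1 := by
    rw [Fin.val_one', Nat.mod_eq_of_lt (by omega)]
  let i2 : Fin (G.diam + 1) := ⟨2, by omega⟩
  have h01 : (0 : Fin (G.diam + 1)) ≠ 1 := fun h => by
    have := congrArg Fin.val h; rw [v1] at this; simp at this
  have h02 : (0 : Fin (G.diam + 1)) ≠ i2 := fun h => by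
    have := congrArg Fin.val h; simp [i2] at this
  have h12 : (1 : Fin (G.diam + 1)) ≠ i2 := fun h => by
    have := congrArg Fin.val h; rw [v1] at this; simp [i2] at this
  -- For `l > 2` the Krein parameter `q^1_{1,l}` vanishes.
  have hvanish : ∀ l : Fin (G.diam + 1), l ∉ ({0, 1, i2} : Finset (Fin (G.diam + 1))) →
      K * (E l : Matrix X X ℝ) = 0 := by
    intro l hl
    rw [hK]
    refine idempotent_mul_diagonal_mul_eq_zero hG hE.primitive
      (hE.krein_eq_zero _ _ _ (Or.inr (Or.inr ?_))) x
    simp only [Finset.mem_insert, Finset.mem_singleton, not_or, Fin.ext_iff, v1, i2,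
      Fin.val_zero] at hl
    rw [v1]
    omega
  have hone : K = K * (E 0 : Matrix X X ℝ) + (K * (E 1 : Matrix X X ℝ) +
      K * (E i2 : Matrix X X ℝ)) := by
    conv_lhs => rw [← mul_one K, ← hE.primitive.sum_eq, Finset.mul_sum]
    rw [← Finset.sum_subset (Finset.subset_univ {0, 1, i2}) fun l _ hl => hvanish l hl,
      Finset.sum_insert (by simp [h01, h02]), Finset.sum_insert (by simp [h12]),
      Finset.sum_singleton]
  have hA : K * distMatrix G 1 = eigenvalue hd1 E 0 • (K * (E 0 : Matrix X X ℝ)) +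
      (eigenvalue hd1 E 1 • (K * (E 1 : Matrix X X ℝ)) +
        eigenvalue hd1 E 2 • (K * (E i2 : Matrix X X ℝ))) := by
    rw [distMatrix_one_eq_sum hd1 E, Finset.mul_sum,
      ← Finset.sum_subset (Finset.subset_univ {0, 1, i2}) fun l _ hl => by
        rw [Matrix.mul_smul, hvanish l hl, smul_zero],
      Finset.sum_insert (by simp [h01, h02]), Finset.sum_insert (by simp [h12]),
      Finset.sum_singleton]
    simp only [Matrix.mul_smul, v1, Fin.val_zero, i2]
  rw [hA]
  conv_rhs => enter [1, 2]; rw [hone]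
  module

/-- `E x̂ ∘ E ŷ` in coordinates, with `x` and `y` at arbitrary positions. -/
theorem coe_nortonMul_hat (S : Matrix X X ℝ) (x y z : X) :
    (nortonMul S (toImage S (hat x)) (toImage S (hat y)) : X → ℝ) z =
      ∑ t, S z t * (S t x * S t y) := by
  change (S *ᵥ ((S *ᵥ hat x) * (S *ᵥ hat y))) z = _
  simp [hat, Matrix.mulVec, dotProduct]

/-- `|X| (θ_1 - θ_2) E x̂ ⋆ E ŷ = E (A x̂ ∘ θ*(y)) - θ_2 θ*_i E x̂ + (θ_2 - θ_0) E ŷ`, where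
`i = ∂(x,y)` and `θ*(y)` has entries `θ*_{∂(y,s)}`. -/
theorem card_mul_nortonMul_apply (hG : G.Connected) (hd : 2 ≤ G.diam)
    {E : Module.Basis (Fin (G.diam + 1)) ℝ (boseMesner G)} (hE : IsQPolynomial E) (x y z : X) :
    (Fintype.card X : ℝ) *
      (eigenvalue (one_le_two.trans hd) E 1 - eigenvalue (one_le_two.trans hd) E 2) *
        ∑ t, (E 1 : Matrix X X ℝ) z t * ((E 1 : Matrix X X ℝ) t x * (E 1 : Matrix X X ℝ) t y) =
      ∑ s, (E 1 : Matrix X X ℝ) z s *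
          (distMatrix G 1 s x * dualEigenvalue hG (E 1) (G.dist y s)) -
        eigenvalue (one_le_two.trans hd) E 2 * dualEigenvalue hG (E 1) (G.dist x y) *
          (E 1 : Matrix X X ℝ) z x +
        (eigenvalue (one_le_two.trans hd) E 2 - eigenvalue (one_le_two.trans hd) E 0) *
          (E 1 : Matrix X X ℝ) z y := by
  have hn := card_ne_zero_of_connected hG
  obtain ⟨K, hK⟩ : ∃ K, K =
      (E 1 : Matrix X X ℝ) * Matrix.diagonal ((E 1 : Matrix X X ℝ) y) := ⟨_, rfl⟩
  have hKapply : ∀ t, K z t = (E 1 : Matrix X X ℝ) z t * (E 1 : Matrix X X ℝ) y t := fun t => by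
    rw [hK, Matrix.mul_diagonal]
  have key := congrFun (congrFun (smul_idempotent_mul_diagonal_mul hG hd hE y hK) z) x
  have hEE : ((E 1 : Matrix X X ℝ) * (E 1 : Matrix X X ℝ)) z y = (E 1 : Matrix X X ℝ) z y := by
    rw [hE.primitive.mul_eq, if_pos rfl]
  simp only [Matrix.sub_apply, Matrix.smul_apply, smul_eq_mul, Matrix.mul_apply,
    hKapply, hE.primitive.trivial_eq, Matrix.of_apply, mul_one] at key hEE
  -- `E_0` has constant entries, so the `K E_0` term reduces to `E E = E` and contributes the
  -- multiple of `E ŷ`.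
  have h0 : ∑ t, (E 1 : Matrix X X ℝ) z t * (E 1 : Matrix X X ℝ) y t * (Fintype.card X : ℝ)⁻¹ =
      (Fintype.card X : ℝ)⁻¹ * (E 1 : Matrix X X ℝ) z y := by
    rw [← Finset.sum_mul, mul_comm, ← hEE]
    simp only [boseMesner_apply_comm (E 1).2 y]
  have h1 : ∑ t, (E 1 : Matrix X X ℝ) z t * ((E 1 : Matrix X X ℝ) t x * (E 1 : Matrix X X ℝ) t y) =
      ∑ t, (E 1 : Matrix X X ℝ) z t * (E 1 : Matrix X X ℝ) y t * (E 1 : Matrix X X ℝ) t x :=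
    Finset.sum_congr rfl fun t _ => by rw [boseMesner_apply_comm (E 1).2 y]; ring
  have h2 : ∑ s, (E 1 : Matrix X X ℝ) z s *
        (distMatrix G 1 s x * dualEigenvalue hG (E 1) (G.dist y s)) =
      (Fintype.card X : ℝ) *
        ∑ s, (E 1 : Matrix X X ℝ) z s * (E 1 : Matrix X X ℝ) y s * distMatrix G 1 s x := by
    rw [Finset.mul_sum]
    refine Finset.sum_congr rfl fun s _ => ?_
    rw [← card_mul_apply_eq_dualEigenvalue]
    ring
  rw [h0] at key
  rw [h1, h2, mul_assoc, key, G.dist_comm, ← card_mul_apply_eq_dualEigenvalue]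
  field_simp
  ring

/-- `E (A x̂ ∘ θ*(y))` when `A x̂ ∘ θ*(y) = θ*_i A x̂ + r`. -/
theorem card_mul_nortonMul_apply_of_eq (hG : G.Connected) (hd : 2 ≤ G.diam)
    {E : Module.Basis (Fin (G.diam + 1)) ℝ (boseMesner G)} (hE : IsQPolynomial E) {x y : X}
    {r : X → ℝ}
    (hr : ∀ s, distMatrix G 1 s x * dualEigenvalue hG (E 1) (G.dist y s) =
      dualEigenvalue hG (E 1) (G.dist x y) * distMatrix G 1 s x + r s) (z : X) :
    (Fintype.card X : ℝ) *
      (eigenvalue (one_le_two.trans hd) E 1 - eigenvalue (one_le_two.trans hd) E 2) *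
        ∑ t, (E 1 : Matrix X X ℝ) z t * ((E 1 : Matrix X X ℝ) t x * (E 1 : Matrix X X ℝ) t y) =
      ((E 1 : Matrix X X ℝ) *ᵥ r) z +
        (eigenvalue (one_le_two.trans hd) E 1 - eigenvalue (one_le_two.trans hd) E 2) *
          dualEigenvalue hG (E 1) (G.dist x y) * (E 1 : Matrix X X ℝ) z x +
        (eigenvalue (one_le_two.trans hd) E 2 - eigenvalue (one_le_two.trans hd) E 0) *
          (E 1 : Matrix X X ℝ) z y := by
  have v1 : ((1 : Fin (G.diam + 1)) : ℕ) = 1 := by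
    rw [Fin.val_one', Nat.mod_eq_of_lt (by omega)]
  have hA := congrFun (congrFun
    (idempotent_mul_distMatrix (one_le_two.trans hd) hE.primitive 1) z) x
  rw [Matrix.mul_apply, Matrix.smul_apply, smul_eq_mul, v1] at hA
  have hsum : ∑ s, (E 1 : Matrix X X ℝ) z s *
        (distMatrix G 1 s x * dualEigenvalue hG (E 1) (G.dist y s)) =
      dualEigenvalue hG (E 1) (G.dist x y) *
        ∑ s, (E 1 : Matrix X X ℝ) z s * distMatrix G 1 s x + ((E 1 : Matrix X X ℝ) *ᵥ r) z := by
    rw [Matrix.mulVec, dotProduct, Finset.mul_sum, ← Finset.sum_add_distrib]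
    exact Finset.sum_congr rfl fun s _ => by rw [hr]; ring
  rw [card_mul_nortonMul_apply hG hd hE, hsum, hA]
  ring

/-- The form `∑_t E_{xt} E_{xt} E_{ty}` is symmetric in `x` and `y`. -/
theorem sum_mul_self_mul_comm {E : Module.Basis (Fin (G.diam + 1)) ℝ (boseMesner G)}
    (hG : G.Connected) (hE : IsPrimitiveIdempotents E) (i : Fin (G.diam + 1)) (x y : X) :
    ∑ t, (E i : Matrix X X ℝ) x t * ((E i : Matrix X X ℝ) t x * (E i : Matrix X X ℝ) t y) =
      ∑ t, (E i : Matrix X X ℝ) y t * ((E i : Matrix X X ℝ) t x * (E i : Matrix X X ℝ) t y) := by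
  -- Multiplying the expansion of `E_i ∘ E_i` by `E_i` leaves only the `E_i` term, and matrices in
  -- `M` are symmetric.
  have hprod : (Fintype.card X : ℝ) •
      (((E i : Matrix X X ℝ) ⊙ (E i : Matrix X X ℝ)) * (E i : Matrix X X ℝ)) =
      kreinParameter E i i i • (E i : Matrix X X ℝ) := by
    rw [← Matrix.smul_mul, card_smul_hadamard_eq_sum]
    simp [Finset.sum_mul, hE.mul_eq]
  have hxy := congrFun (congrFun hprod x) y
  have hyx := congrFun (congrFun hprod y) x
  simp only [Matrix.smul_apply, smul_eq_mul, Matrix.mul_apply, Matrix.hadamard_apply] at hxy hyx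
  rw [boseMesner_apply_comm (E i).2 y x, ← hxy] at hyx
  have h := mul_left_cancel₀ (card_ne_zero_of_connected hG) hyx.symm
  calc _ = ∑ t, (E i : Matrix X X ℝ) x t * (E i : Matrix X X ℝ) x t * (E i : Matrix X X ℝ) t y :=
        Finset.sum_congr rfl fun t _ => by rw [boseMesner_apply_comm (E i).2 t x]; ring
    _ = _ := h
    _ = _ := Finset.sum_congr rfl fun t _ => by rw [boseMesner_apply_comm (E i).2 t y]; ring

/-- The `x`- and `y`-entries of `E x̂ ⋆ E ŷ` agree, so subtracting the two evaluations of the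
preceding formula leaves a relation free of the Norton product. It supplies the scalar identity for
the coefficient of `E x̂`. -/
theorem card_mul_mulVec_sub_mulVec (hG : G.Connected) (hd : 2 ≤ G.diam)
    {E : Module.Basis (Fin (G.diam + 1)) ℝ (boseMesner G)} (hE : IsQPolynomial E) {x y : X}
    {r : X → ℝ}
    (hr : ∀ s, distMatrix G 1 s x * dualEigenvalue hG (E 1) (G.dist y s) =
      dualEigenvalue hG (E 1) (G.dist x y) * distMatrix G 1 s x + r s) :
    (Fintype.card X : ℝ) * ((E 1 : Matrix X X ℝ) *ᵥ r) x -
        (Fintype.card X : ℝ) * ((E 1 : Matrix X X ℝ) *ᵥ r) y =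
      (dualEigenvalue hG (E 1) 0 - dualEigenvalue hG (E 1) (G.dist x y)) *
        ((eigenvalue (one_le_two.trans hd) E 2 - eigenvalue (one_le_two.trans hd) E 0) -
          (eigenvalue (one_le_two.trans hd) E 1 - eigenvalue (one_le_two.trans hd) E 2) *
            dualEigenvalue hG (E 1) (G.dist x y)) := by
  have hx := card_mul_nortonMul_apply_of_eq hG hd hE hr x
  have hy := card_mul_nortonMul_apply_of_eq hG hd hE hr y
  rw [sum_mul_self_mul_comm hG hE.primitive, hy] at hx
  have e0 := card_mul_apply_eq_dualEigenvalue hG (E 1) x x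
  have e1 := card_mul_apply_eq_dualEigenvalue hG (E 1) y y
  have e2 := card_mul_apply_eq_dualEigenvalue hG (E 1) x y
  rw [SimpleGraph.dist_self] at e0 e1
  rw [boseMesner_apply_comm (E 1).2 y x] at hx
  set θ := eigenvalue (one_le_two.trans hd) E
  set θs := dualEigenvalue hG (E 1)
  linear_combination (-(Fintype.card X : ℝ)) * hx -
    (θ 1 - θ 2) * θs (G.dist x y) * e0 + (θ 2 - θ 0) * e1 +
    ((θ 1 - θ 2) * θs (G.dist x y) - (θ 2 - θ 0)) * e2

theorem distMatrix_mulVec_hat (i : ℕ) (x : X) :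
    distMatrix G i *ᵥ hat x = fun s => distMatrix G i s x := by
  ext s
  simp [hat]

theorem distMatrix_mulVec_hat_mul_apply (i j : ℕ) (x y s : X) :
    ((distMatrix G i *ᵥ hat x) * (distMatrix G j *ᵥ hat y)) s =
      if G.dist s x = i ∧ G.dist s y = j then 1 else 0 := by
  rw [distMatrix_mulVec_hat, distMatrix_mulVec_hat, ite_and]
  by_cases h : G.dist s x = i <;> simp [distMatrix, h]

/-- If every vertex of `Γ_i(x) ∩ Γ_j(y)` is at distance `k` from `z`, then the `z`-entry of
`F (A_i x̂ ∘ A_j ŷ)` is `|X|⁻¹ |Γ_i(x) ∩ Γ_j(y)| θ*_k`. -/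
theorem card_mul_mulVec_inter (hG : G.Connected) (F : boseMesner G) {i j k : ℕ} {x y z : X}
    (h : ∀ s, G.dist s x = i → G.dist s y = j → G.dist z s = k) :
    (Fintype.card X : ℝ) * ((F : Matrix X X ℝ) *ᵥ
        ((distMatrix G i *ᵥ hat x) * (distMatrix G j *ᵥ hat y))) z =
      ((sphere G i x ∩ sphere G j y).card : ℝ) * dualEigenvalue hG F k := by
  rw [Matrix.mulVec, dotProduct, Finset.mul_sum, Finset.card_eq_sum_ones, Nat.cast_sum, sphere,
    sphere, ← Finset.filter_and, Finset.sum_filter, Finset.sum_mul]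
  refine Finset.sum_congr rfl fun s _ => ?_
  rw [← mul_assoc, card_mul_apply_eq_dualEigenvalue hG, distMatrix_mulVec_hat_mul_apply,
    G.dist_comm (u := x), G.dist_comm (u := y)]
  split_ifs with h1
  · rw [h s h1.1 h1.2]
    simp
  · simp

end TripleProduct

end NortonDRG

/-! ### The two formulas, at distance `1` and at distance `d` -/

open scoped Matrix

theorem corollary4p5 {X : Type*} [Fintype X] [DecidableEq X] (G : SimpleGraph X)
    (hG : DistanceRegular G) (hd : 2 ≤ G.diam)
    (E : Module.Basis (Fin (G.diam + 1)) ℝ (boseMesner G)) (hE : IsQPolynomial E) :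
    let F : boseMesner G := E 1
    let θ : ℕ → ℝ := eigenvalue (one_le_two.trans hd) E
    let θs : ℕ → ℝ := dualEigenvalue hG.connected F
    let e : X → imageSpace (F : Matrix X X ℝ) := fun x => toImage (F : Matrix X X ℝ) (hat x)
    (∀ x y : X, G.dist x y = 1 →
      nortonMul (F : Matrix X X ℝ) (e x) (e y) =
        ((Fintype.card X : ℝ) * (θ 1 - θ 2))⁻¹ •
          ((θs 2 - θs 1) • vecB hG.connected F x y +
            (θ 2 - θ 0 + θs 0 - θs 1) • (e x + e y))) ∧
    (∀ x y : X, G.dist x y = G.diam →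
      nortonMul (F : Matrix X X ℝ) (e x) (e y) =
        ((Fintype.card X : ℝ) * (θ 1 - θ 2))⁻¹ •
          ((θs (G.diam - 1) - θs G.diam) • vecC hG.connected F x y +
            (θ 2 - θ 0) • (e x + e y))) := by
  intro F θ θs e
  have hC := hG.connected
  have hn : (Fintype.card X : ℝ) ≠ 0 := card_ne_zero_of_connected hC
  have v1 : ((1 : Fin (G.diam + 1)) : ℕ) = 1 := by
    rw [Fin.val_one', Nat.mod_eq_of_lt (by omega)]
  have hθ : θ 1 - θ 2 ≠ 0 := by
    have h12 : (1 : Fin (G.diam + 1)) ≠ ⟨2, by omega⟩ := fun h => by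
      have := congrArg Fin.val h
      rw [v1] at this
      simp at this
    have := eigenvalue_ne hG (one_le_two.trans hd) hE.primitive h12
    rw [v1] at this
    exact sub_ne_zero.mpr this
  have hhat : ∀ x z, ((F : Matrix X X ℝ) *ᵥ hat x) z = (F : Matrix X X ℝ) z x := by
    intro x z
    simp [hat]
  constructor
  · intro x y hxy
    have hne : x ≠ y := by
      rintro rfl
      simp at hxy
    have hθs : θs 0 - θs 1 ≠ 0 :=
      sub_ne_zero.mpr (hxy ▸ dualEigenvalue_zero_ne hC hE (one_le_two.trans hd) hne)
    have hplus : xPlus G x y = (distMatrix G 1 *ᵥ hat x) * (distMatrix G 2 *ᵥ hat y) := by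
      rw [xPlus, hxy]
    -- A neighbour of `x` is `y` itself (the `ŷ` term), or is at distance `1` from `y` (no
    -- correction) or `2` (the `x⁺_y` term).
    have hr : ∀ s, distMatrix G 1 s x * dualEigenvalue hG.connected (E 1) (G.dist y s) =
        dualEigenvalue hG.connected (E 1) (G.dist x y) * distMatrix G 1 s x +
          ((θs 0 - θs 1) • hat y + (θs 2 - θs 1) • xPlus G x y) s := by
      intro s
      have hb := hC.dist_triangle (u := s) (v := x) (w := y)
      rw [Pi.add_apply, Pi.smul_apply, Pi.smul_apply, hplus, distMatrix_mulVec_hat_mul_apply]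
      simp only [smul_eq_mul, distMatrix, Matrix.of_apply, hat, Pi.single_apply, hxy,
        G.dist_comm (u := y) (v := s)]
      by_cases hs : s = y
      · subst hs
        simp [G.dist_comm (u := s), hxy, θs, F]
      · have hpos := hC.pos_dist_of_ne hs
        by_cases h1 : G.dist s x = 1
        · have : G.dist s y = 1 ∨ G.dist s y = 2 := by omega
          rcases this with h2 | h2 <;> simp [hs, h1, h2, θs, F]
        · simp [hs, h1]
    have hb : ((sphere G 1 x ∩ sphere G 2 y).card : ℝ) = b G 1 := by
      rw [b, hG.intersectionNumber_eq (by omega) (by omega) (by omega) hxy]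
    have hdiff := card_mul_mulVec_sub_mulVec hC hd hE hr
    -- The `b_1` vertices in the support of `x⁺_y` are all at distance `1` from `x` and `2` from
    -- `y`, which evaluates both entries of `E x⁺_y`.
    have hPx := card_mul_mulVec_inter hC F (i := 1) (j := 2) (k := 1) (x := x) (y := y) (z := x)
      fun s h _ => by rw [G.dist_comm, h]
    have hPy := card_mul_mulVec_inter hC F (i := 1) (j := 2) (k := 2) (x := x) (y := y) (z := y)
      fun s _ h => by rw [G.dist_comm, h]
    rw [hb, ← hplus] at hPx hPy
    have e1 := card_mul_apply_eq_dualEigenvalue hC F x y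
    have e0 := card_mul_apply_eq_dualEigenvalue hC F y y
    rw [SimpleGraph.dist_self] at e0
    simp only [Matrix.mulVec_add, Matrix.mulVec_smul, Pi.add_apply, Pi.smul_apply,
      smul_eq_mul] at hdiff
    change (Fintype.card X : ℝ) * ((θs 0 - θs 1) * ((F : Matrix X X ℝ) *ᵥ hat y) x +
      (θs 2 - θs 1) * ((F : Matrix X X ℝ) *ᵥ xPlus G x y) x) - (Fintype.card X : ℝ) *
      ((θs 0 - θs 1) * ((F : Matrix X X ℝ) *ᵥ hat y) y +
      (θs 2 - θs 1) * ((F : Matrix X X ℝ) *ᵥ xPlus G x y) y) =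
      (θs 0 - θs (G.dist x y)) * ((θ 2 - θ 0) - (θ 1 - θ 2) * θs (G.dist x y)) at hdiff
    rw [hhat, hhat] at hdiff
    change _ = θs _ at e1 e0
    change _ = _ * θs _ at hPx hPy
    rw [hxy] at hdiff e1
    -- The left side is the coefficient of `E x̂` found above; the right side is its coefficient in
    -- the claim, with the `E x̂` part of `B(x,y)` included. This is `hdiff` divided by `θ*_0 -
    -- θ*_1`.
    have hscal : (θ 1 - θ 2) * θs 1 = (θs 2 - θs 1) *
        -(b G 1 * ((θs 1 - θs 2) / (θs 0 - θs 1))) + (θ 2 - θ 0 + θs 0 - θs 1) := by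
      field_simp
      linear_combination hdiff - (θs 0 - θs 1) * e1 + (θs 0 - θs 1) * e0 -
        (θs 2 - θs 1) * hPx + (θs 2 - θs 1) * hPy
    refine Subtype.ext (funext fun z => ?_)
    have hmain := card_mul_nortonMul_apply_of_eq hC hd hE hr z
    rw [← coe_nortonMul_hat] at hmain
    change _ * (θ 1 - θ 2) * (nortonMul (F : Matrix X X ℝ) (e x) (e y) : X → ℝ) z = _ +
      (θ 1 - θ 2) * θs (G.dist x y) * (F : Matrix X X ℝ) z x +
        (θ 2 - θ 0) * (F : Matrix X X ℝ) z y at hmain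
    simp only [Matrix.mulVec_add, Matrix.mulVec_smul, Pi.add_apply, Pi.smul_apply,
      smul_eq_mul] at hmain
    change _ = (θs 0 - θs 1) * ((F : Matrix X X ℝ) *ᵥ hat y) z +
      (θs 2 - θs 1) * ((F : Matrix X X ℝ) *ᵥ xPlus G x y) z + _ + _ at hmain
    rw [hhat, hxy, hscal] at hmain
    change _ = (_ : ℝ)⁻¹ * ((θs 2 - θs 1) * (((F : Matrix X X ℝ) *ᵥ xPlus G x y) z -
      ((b G (G.dist x y) : ℝ) * ((θs 1 - θs (G.dist x y + 1)) / (θs 0 - θs (G.dist x y)))) *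
        ((F : Matrix X X ℝ) *ᵥ hat x) z) + (θ 2 - θ 0 + θs 0 - θs 1) *
        (((F : Matrix X X ℝ) *ᵥ hat x) z + ((F : Matrix X X ℝ) *ᵥ hat y) z))
    rw [hhat, hhat, hxy, eq_inv_mul_iff_mul_eq₀ (mul_ne_zero hn hθ), hmain]
    ring
  · intro x y hxy
    have hne : x ≠ y := by
      rintro rfl
      rw [SimpleGraph.dist_self] at hxy
      omega
    have hθs : θs 0 - θs G.diam ≠ 0 :=
      sub_ne_zero.mpr (hxy ▸ dualEigenvalue_zero_ne hC hE (one_le_two.trans hd) hne)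
    have hminus : xMinus G x y =
        (distMatrix G 1 *ᵥ hat x) * (distMatrix G (G.diam - 1) *ᵥ hat y) := by
      rw [xMinus, hxy, if_neg (by omega)]
    -- No vertex is beyond distance `d` from `y`, so only neighbours of `x` at distance `d-1` need a
    -- correction. As `d ≥ 2`, `y` is not a neighbour of `x` and no `ŷ` term appears.
    have hr : ∀ s, distMatrix G 1 s x * dualEigenvalue hG.connected (E 1) (G.dist y s) =
        dualEigenvalue hG.connected (E 1) (G.dist x y) * distMatrix G 1 s x +
          ((θs (G.diam - 1) - θs G.diam) • xMinus G x y) s := by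
      intro s
      have htri := hC.dist_triangle (u := x) (v := s) (w := y)
      rw [G.dist_comm (u := x) (v := s), hxy] at htri
      have hle := dist_lt_diam_add_one hC s y
      rw [Pi.smul_apply, hminus, distMatrix_mulVec_hat_mul_apply]
      simp only [smul_eq_mul, distMatrix, Matrix.of_apply, hxy, G.dist_comm (u := y) (v := s)]
      by_cases h1 : G.dist s x = 1
      · have : G.dist s y = G.diam - 1 ∨ G.dist s y = G.diam := by omega
        rcases this with h2 | h2
        · simp [h1, h2, θs, F]
        · have : G.diam ≠ G.diam - 1 := by omega
          simp [h1, h2, this]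
      · simp [h1]
    have hc : ((sphere G 1 x ∩ sphere G (G.diam - 1) y).card : ℝ) = c G G.diam := by
      rw [c, if_neg (by omega),
        hG.intersectionNumber_eq le_rfl (by omega) (by omega) hxy]
    have hdiff := card_mul_mulVec_sub_mulVec hC hd hE hr
    have hPx := card_mul_mulVec_inter hC F (i := 1) (j := G.diam - 1) (k := 1)
      (x := x) (y := y) (z := x) fun s h _ => by rw [G.dist_comm, h]
    have hPy := card_mul_mulVec_inter hC F (i := 1) (j := G.diam - 1) (k := G.diam - 1)
      (x := x) (y := y) (z := y) fun s _ h => by rw [G.dist_comm, h]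
    rw [hc, ← hminus] at hPx hPy
    simp only [Matrix.mulVec_smul, Pi.smul_apply, smul_eq_mul] at hdiff
    change (Fintype.card X : ℝ) *
      ((θs (G.diam - 1) - θs G.diam) * ((F : Matrix X X ℝ) *ᵥ xMinus G x y) x) -
      (Fintype.card X : ℝ) *
      ((θs (G.diam - 1) - θs G.diam) * ((F : Matrix X X ℝ) *ᵥ xMinus G x y) y) =
      (θs 0 - θs (G.dist x y)) * ((θ 2 - θ 0) - (θ 1 - θ 2) * θs (G.dist x y)) at hdiff
    change _ = _ * θs _ at hPx hPy
    rw [hxy] at hdiff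
    -- Again the two coefficients of `E x̂` are matched, now using the `c_d` vertices in the support
    -- of `x⁻_y`, at distance `1` from `x` and `d-1` from `y`.
    have hscal : (θ 1 - θ 2) * θs G.diam = (θs (G.diam - 1) - θs G.diam) *
        -(c G G.diam * ((θs 1 - θs (G.diam - 1)) / (θs 0 - θs G.diam))) + (θ 2 - θ 0) := by
      field_simp
      linear_combination hdiff - (θs (G.diam - 1) - θs G.diam) * hPx +
        (θs (G.diam - 1) - θs G.diam) * hPy
    refine Subtype.ext (funext fun z => ?_)
    have hmain := card_mul_nortonMul_apply_of_eq hC hd hE hr z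
    rw [← coe_nortonMul_hat] at hmain
    change _ * (θ 1 - θ 2) * (nortonMul (F : Matrix X X ℝ) (e x) (e y) : X → ℝ) z = _ +
      (θ 1 - θ 2) * θs (G.dist x y) * (F : Matrix X X ℝ) z x +
        (θ 2 - θ 0) * (F : Matrix X X ℝ) z y at hmain
    simp only [Matrix.mulVec_smul, Pi.smul_apply, smul_eq_mul] at hmain
    change _ = (θs (G.diam - 1) - θs G.diam) * ((F : Matrix X X ℝ) *ᵥ xMinus G x y) z +
      _ + _ at hmain
    rw [hxy, hscal] at hmain
    change _ = (_ : ℝ)⁻¹ * ((θs (G.diam - 1) - θs G.diam) *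
      (((F : Matrix X X ℝ) *ᵥ xMinus G x y) z -
      ((c G (G.dist x y) : ℝ) * ((θs 1 - θs (G.dist x y - 1)) / (θs 0 - θs (G.dist x y)))) *
        ((F : Matrix X X ℝ) *ᵥ hat x) z) + (θ 2 - θ 0) *
        (((F : Matrix X X ℝ) *ᵥ hat x) z + ((F : Matrix X X ℝ) *ᵥ hat y) z))
    rw [hhat, hhat, hxy, eq_inv_mul_iff_mul_eq₀ (mul_ne_zero hn hθ), hmain]
    ring
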